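/- **System.** There are $n$ validator nodes, of which at most $f$ are Byzantine, where $f<n/3$; the others are correct and follow the protocol below. Nodes exchange messages over authenticated point-to-point channels: a message received by a correct node as coming from a correct node was sent by that node. Byzantine nodes may send any messages to any nodes at any time. No bound on message delays or local speeds is required, so the statement holds in particular for all partially synchronous executions. **Protocol (SRBB).** A correct node executes consensus instances $1,2,3,\dots$ one after the other. In instance $i$ it reliably broadcasts the block at the head of its queue of pending blocks (if there is one) and takes part in $n$ binary consensuses, one for each node. * *Reliable broadcast (Bracha).* The broadcaster sends $\mathrm{INIT}(v)$ to all. A node sends $\mathrm{ECHO}(v)$, for at most one $v$ per broadcast, after receiving $\mathrm{INIT}(v)$ from the broadcaster, or $\mathrm{ECHO}(v)$ from more than $(n+f)/2$ nodes, or $\mathrm{READY}(v)$ from $f+1$ nodes; it sends $\mathrm{READY}(v)$, for at most one $v$ per broadcast, after receiving $\mathrm{ECHO}(v)$ from more than $(n+f)/2$ nodes or $\mathrm{READY}(v)$ from $f+1$ nodes; it delivers $v$ (once) after receiving $\mathrm{READY}(v)$ from $2f+1$ nodes. * *Reduction to binary consensus.* When a node delivers the block broadcast by node $k$ in instance $i$,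 it proposes true to binary consensus $(i,k)$. Once a node running instance $i$ has decided true in some binary consensus of that instance, it may propose false to binary consensus $(i,j)$ for any $j$ whose block it has not delivered. Only the first proposal of a node to a binary consensus counts. When all $n$ binary consensuses of instance $i$ have decided at the node, and every block $k$ for which true was decided has been delivered to it, the node decides the *superblock* of instance $i$: the list, ordered by $k$, of the delivered blocks for which true was decided. It removes its own block from its queue if that block is in the superblock. * *Binary consensus (DBFT).* The node sets its estimate $e$ to its proposal and runs rounds $r=1,2,\dots$. In round $r$ it sends $\mathrm{EST}_r(e)$ to all. At any time, a node that received $\mathrm{EST}_r(b)$ from $f+1$ nodes may send $\mathrm{EST}_r(b)$ itself, if it has not yet done so, and on receiving it from $2f+1$ nodes it adds $b$ to its set $B_r$. The coordinator of round $r$ (node $(r-1)\bmod n$, nodes being numbered from $0$) sends $\mathrm{COORD}_r(w)$ for one $w\in B_r$. When $B_r\neq\emptyset$ (and after a timer, which may expire at any time), the node sends $\mathrm{AUX}_r(S)$ to all, where $S=\{w\}$ for some $\mathrm{COORD}_r(w)$ received from the coordinator with $w\in B_r$ if there is one, and $S=B_r$ otherwise. When it has received messages $\mathrm{AUX}_r(S_q)$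 from $n-f$ distinct nodes $q$ with $V=\bigcup_q S_q\subseteq B_r$, it ends the round: if $V=\{v\}$, it sets $e=v$, and decides $v$ if $v=r\bmod 2$ and it has not decided before (true being $1$ and false being $0$); otherwise it sets $e=r\bmod 2$. Then it starts round $r+1$. **Local chain.** All nodes start with the same genesis block and genesis state and use the same deterministic execution engine. A correct node processes its decided superblocks in the order of the instances, and the blocks of a superblock one at a time in order: it deserializes the block, keeps the set of those transactions that are valid in its current state, executes them in a deterministic order, and appends to its chain a block consisting of these transactions and a header with the block number, the hash of the previous header, and the roots of the state, transaction and receipt tries. The chain that results so far is the local chain of the node. **Theorem (safety).** In every execution of SRBB, for any two correct validator nodes $p,q$ and any two times $s,t$ (in particular $s=t$), the local chain of $p$ at time $s$ and the local chain of $q$ at time $t$ are either identical or one is a prefix of the other. -/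

import Mathlib

namespace SRBB

/-! ### The virtual machine: execution of decided blocks and the local chain -/

/-- Header of a block of the chain: block number, pointer to the previous block, and the roots of
the state, transaction and receipt tries. -/
structure Header (Hash : Type*) where
  number : ℕ
  parent : Hash
  stateRoot : Hash
  txRoot : Hash
  receiptRoot : Hash

/-- A block of the local chain: its header and the list of transactions persisted with it. -/
structure ChainBlock (Tx Hash : Type*) where
  header : Header Hash
  txs : List Tx

/-- An execution engine. `Payload` is the type of serialized blocks (byte arrays) on which
consensus is run. The engine is an arbitrary deterministic one; in particular `executeTx` may leave
the state unchanged when an execution fails, and the hash functions are not assumed injective. -/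
structure VM (Payload Tx State Receipt Hash : Type*) where
  /-- transactions encoded in a serialized block -/
  deserialize : Payload → List Tx
  /-- lazy validation of a transaction in a state -/
  isValid : State → Tx → Bool
  /-- the order in which a set of valid transactions is executed -/
  order : State → Finset Tx → List Tx
  order_nodup : ∀ s v, (order s v).Nodup
  mem_order : ∀ s v t, t ∈ order s v ↔ t ∈ v
  /-- execution of one transaction: new state and receipt -/
  executeTx : State → Tx → State × Receipt
  stateRoot : State → Hash
  txRoot : List Tx → Hash
  receiptRoot : List Receipt → Hash
  hashHeader : Header Hash → Hash
  genesisState : State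
  genesisBlock : ChainBlock Tx Hash

section VM

variable {Payload Tx State Receipt Hash : Type*}

/-- Sequential execution of a list of transactions, collecting the receipts. -/
def VM.executeAll (vm : VM Payload Tx State Receipt Hash) :
    State → List Tx → State × List Receipt
  | s, [] => (s, [])
  | s, t :: ts =>
    let r := vm.executeTx s t
    let rest := vm.executeAll r.1 ts
    (rest.1, r.2 :: rest.2)

/-- The set of transactions of a serialized block that pass lazy validation, in execution order. -/
def VM.validTxs [DecidableEq Tx] (vm : VM Payload Tx State Receipt Hash) (s : State)
    (b : Payload) : List Tx :=
  vm.order s ((vm.deserialize b).filter (vm.isValid s)).toFinset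

/-- Processing of one block of a superblock: lazy validation, execution, and insertion at the end
of the chain with a pointer to the previous block. -/
def VM.processBlock [DecidableEq Tx] (vm : VM Payload Tx State Receipt Hash)
    (sc : State × List (ChainBlock Tx Hash)) (b : Payload) :
    State × List (ChainBlock Tx Hash) :=
  let txs := vm.validTxs sc.1 b
  let res := vm.executeAll sc.1 txs
  let header : Header Hash :=
    { number := sc.2.length
      parent := vm.hashHeader (sc.2.getLastD vm.genesisBlock).header
      stateRoot := vm.stateRoot res.1
      txRoot := vm.txRoot txs
      receiptRoot := vm.receiptRoot res.2 }
  (res.1, sc.2 ++ [{ header := header, txs := txs }])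

end VM

/-! ### Messages and local states -/

/-- Messages. The first argument `i` is the consensus instance. `init`, `echo`, `ready` are the
messages of the reliable broadcast (`src` is the broadcaster; for `init` it is the sender);
`est`, `coord`, `aux` are those of round `r` of the binary consensus with index `k`. -/
inductive Msg (n : ℕ) (Payload : Type*) where
  | init (i : ℕ) (v : Payload)
  | echo (i : ℕ) (src : Fin n) (v : Payload)
  | ready (i : ℕ) (src : Fin n) (v : Payload)
  | est (i : ℕ) (k : Fin n) (r : ℕ) (b : Bool)
  | coord (i : ℕ) (k : Fin n) (r : ℕ) (b : Bool)
  | aux (i : ℕ) (k : Fin n) (r : ℕ) (s : Finset Bool)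

/-- Position inside a round of the binary consensus: before or after broadcasting `aux`. -/
inductive Phase where
  | beforeAux
  | afterAux

/-- Local state of one binary consensus. `round = 0` means that it has not been invoked yet. -/
structure BinState where
  round : ℕ
  phase : Phase
  est : Bool
  binValues : ℕ → Finset Bool
  decided : Option Bool

/-- The state of a binary consensus before it is invoked. -/
def BinState.initial : BinState where
  round := 0
  phase := Phase.beforeAux
  est := false
  binValues := fun _ => ∅
  decided := none

/-- Local state of a validator node. `received` holds pairs (sender, message); `delivered (i, k)`
is the block reliably delivered from `k` in instance `i` (the array `blocks`); `bin (i, k)` is the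
state of binary consensus `k` of instance `i`; `commitChan` is the queue of superblocks on their
way to the execution engine and `pending` the blocks of the current superblock still to process. -/
structure NodeState (n : ℕ) (Payload Tx State Hash : Type*) where
  received : Set (Fin n × Msg n Payload)
  sent : Set (Msg n Payload)
  index : ℕ
  running : Bool
  myBlock : Option Payload
  blockQueue : List Payload
  delivered : ℕ × Fin n → Option Payload
  bin : ℕ × Fin n → BinState
  commitChan : List (List Payload)
  pending : List Payload
  vmState : State
  chain : List (ChainBlock Tx Hash)

section Protocol

variable {n : ℕ} {Payload Tx State Receipt Hash : Type*}

/-- The state of a node at the start: every node starts from the genesis state and block. -/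
def NodeState.initial (n : ℕ) (vm : VM Payload Tx State Receipt Hash) :
    NodeState n Payload Tx State Hash where
  received := ∅
  sent := ∅
  index := 0
  running := false
  myBlock := none
  blockQueue := []
  delivered := fun _ => none
  bin := fun _ => BinState.initial
  commitChan := []
  pending := []
  vmState := vm.genesisState
  chain := [vm.genesisBlock]

/-- Number of distinct nodes from which `m` has been received. -/
noncomputable def NodeState.count (σ : NodeState n Payload Tx State Hash) (m : Msg n Payload) : ℕ :=
  {q : Fin n | (q, m) ∈ σ.received}.ncard

/-- Send `m` to all nodes. -/
def NodeState.broadcast (σ : NodeState n Payload Tx State Hash) (m : Msg n Payload) :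
    NodeState n Payload Tx State Hash :=
  { σ with sent := insert m σ.sent }

/-- Replace the state of binary consensus `k` of instance `i`. -/
def NodeState.setBin (σ : NodeState n Payload Tx State Hash) (i : ℕ) (k : Fin n) (β : BinState) :
    NodeState n Payload Tx State Hash :=
  { σ with bin := Function.update σ.bin (i, k) β }

/-- Invoke binary consensus `k` of instance `i` with input `b`; only the first invocation has an
effect. The node enters round 1 with estimate `b`, which it broadcasts. -/
def NodeState.binPropose (σ : NodeState n Payload Tx State Hash) (i : ℕ) (k : Fin n) (b : Bool) :
    NodeState n Payload Tx State Hash :=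
  if (σ.bin (i, k)).round = 0 then
    (σ.setBin i k { σ.bin (i, k) with round := 1, phase := Phase.beforeAux, est := b }).broadcast
      (Msg.est i k 1 b)
  else σ

/-- The bit `r mod 2`. -/
def parity (r : ℕ) : Bool := decide (r % 2 = 1)

/-- `c` is the coordinator of round `r ≥ 1`. -/
def IsCoord (r : ℕ) (c : Fin n) : Prop := (c : ℕ) = (r - 1) % n

/-- End of a round with collected set `vals`: if `vals = {v}` then `v` becomes the estimate, and is
decided if it equals the parity of the round and nothing was decided before; otherwise the parity
becomes the estimate. Then the node moves on to the next round. -/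
def BinState.endRound (β : BinState) (vals : Finset Bool) : BinState :=
  let b := parity β.round
  { β with
    round := β.round + 1
    phase := Phase.beforeAux
    est := if vals = {!b} then !b else b
    decided := if vals = {b} then β.decided.or (some b) else β.decided }

/-- The superblock of instance `i`: the delivered blocks, in the order of the identifiers of their
proposers, for which the binary consensus decided `true`. -/
def NodeState.superblock (σ : NodeState n Payload Tx State Hash) (i : ℕ) : List Payload :=
  (List.finRange n).filterMap fun k =>
    if (σ.bin (i, k)).decided = some true then σ.delivered (i, k) else none

/-- Start of a new consensus instance: the node increments its index and reliably broadcasts the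
head of its queue, if there is one. -/
def NodeState.startNewConsensus (σ : NodeState n Payload Tx State Hash) :
    NodeState n Payload Tx State Hash :=
  { σ with
    index := σ.index + 1
    running := true
    myBlock := σ.blockQueue.head?
    sent := match σ.blockQueue.head? with
      | some b => insert (Msg.init (σ.index + 1) b) σ.sent
      | none => σ.sent }

open Classical in
/-- Decision of the superblock of the current instance: it is handed to the execution engine, and
the node's own block leaves the queue if it is in the superblock. -/
noncomputable def NodeState.decideSuperblock (σ : NodeState n Payload Tx State Hash) :
    NodeState n Payload Tx State Hash :=
  { σ with
    running := false
    blockQueue := if ∃ b ∈ σ.superblock σ.index, σ.myBlock = some b then σ.blockQueue.tail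
      else σ.blockQueue
    commitChan := σ.commitChan ++ [σ.superblock σ.index] }

/-! ### The protocol -/

/-- The local steps of a correct node `p`, where `f` is the resilience parameter. Waiting for a
timer of the binary consensus is modelled by nondeterminism: timers may expire at any time. -/
inductive LocalStep [DecidableEq Tx] (vm : VM Payload Tx State Receipt Hash) (f : ℕ) (p : Fin n) :
    NodeState n Payload Tx State Hash → NodeState n Payload Tx State Hash → Prop
  /-- the transaction pool produces a block to propose -/
  | enqueue (σ) (b : Payload) :
      LocalStep vm f p σ { σ with blockQueue := σ.blockQueue ++ [b] }
  | start (σ) (hidle : σ.running = false) :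
      LocalStep vm f p σ σ.startNewConsensus
  /-- reliable broadcast, first step (at most one `echo` per broadcast) -/
  | echo (σ) (i : ℕ) (src : Fin n) (v : Payload)
      (hnew : ∀ w, Msg.echo i src w ∉ σ.sent)
      (htrigger : (src, Msg.init i v) ∈ σ.received ∨ n + f < 2 * σ.count (Msg.echo i src v) ∨
        f + 1 ≤ σ.count (Msg.ready i src v)) :
      LocalStep vm f p σ (σ.broadcast (Msg.echo i src v))
  /-- reliable broadcast, second step (at most one `ready` per broadcast) -/
  | ready (σ) (i : ℕ) (src : Fin n) (v : Payload)
      (hnew : ∀ w, Msg.ready i src w ∉ σ.sent)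
      (htrigger : n + f < 2 * σ.count (Msg.echo i src v) ∨
        f + 1 ≤ σ.count (Msg.ready i src v)) :
      LocalStep vm f p σ (σ.broadcast (Msg.ready i src v))
  /-- reliable broadcast, delivery; it triggers the binary consensus of `src` with input `true` -/
  | deliver (σ) (i : ℕ) (src : Fin n) (v : Payload)
      (hnew : σ.delivered (i, src) = none)
      (hquorum : 2 * f + 1 ≤ σ.count (Msg.ready i src v)) :
      LocalStep vm f p σ
        (({ σ with delivered := Function.update σ.delivered (i, src) (some v) }).binPropose
          i src true)
  /-- once some binary consensus decided `true`, those of undelivered blocks are invoked with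
  input `false` -/
  | proposeFalse (σ) (j k : Fin n) (hrun : σ.running = true)
      (hdec : (σ.bin (σ.index, k)).decided = some true)
      (hnull : σ.delivered (σ.index, j) = none) :
      LocalStep vm f p σ (σ.binPropose σ.index j false)
  /-- binary-value broadcast: relay of a value received from `f + 1` nodes -/
  | bvRelay (σ) (i : ℕ) (k : Fin n) (r : ℕ) (b : Bool)
      (hnew : Msg.est i k r b ∉ σ.sent)
      (hquorum : f + 1 ≤ σ.count (Msg.est i k r b)) :
      LocalStep vm f p σ (σ.broadcast (Msg.est i k r b))
  /-- binary-value broadcast: delivery of a value received from `2 f + 1` nodes -/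
  | bvDeliver (σ) (i : ℕ) (k : Fin n) (r : ℕ) (b : Bool)
      (hquorum : 2 * f + 1 ≤ σ.count (Msg.est i k r b)) :
      LocalStep vm f p σ
        (σ.setBin i k { σ.bin (i, k) with
          binValues := Function.update (σ.bin (i, k)).binValues r
            (insert b ((σ.bin (i, k)).binValues r)) })
  /-- the coordinator of the round broadcasts a value of its set of delivered values -/
  | coord (σ) (i : ℕ) (k : Fin n) (r : ℕ) (w : Bool)
      (hr : (σ.bin (i, k)).round = r) (hpos : 1 ≤ r) (hc : IsCoord r p)
      (hw : w ∈ (σ.bin (i, k)).binValues r)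
      (hnew : ∀ b, Msg.coord i k r b ∉ σ.sent) :
      LocalStep vm f p σ (σ.broadcast (Msg.coord i k r w))
  /-- once some value is delivered, broadcast the coordinator's value if it was received and is
  delivered, and the set of all delivered values otherwise -/
  | aux (σ) (i : ℕ) (k : Fin n) (r : ℕ) (s : Finset Bool)
      (hr : (σ.bin (i, k)).round = r) (hpos : 1 ≤ r)
      (hphase : (σ.bin (i, k)).phase = Phase.beforeAux)
      (hne : (σ.bin (i, k)).binValues r ≠ ∅)
      (hs : (∃ c w, IsCoord r c ∧ (c, Msg.coord i k r w) ∈ σ.received ∧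
            w ∈ (σ.bin (i, k)).binValues r ∧ s = {w}) ∨
          ((¬ ∃ c w, IsCoord r c ∧ (c, Msg.coord i k r w) ∈ σ.received ∧
            w ∈ (σ.bin (i, k)).binValues r) ∧ s = (σ.bin (i, k)).binValues r)) :
      LocalStep vm f p σ
        ((σ.setBin i k { σ.bin (i, k) with phase := Phase.afterAux }).broadcast (Msg.aux i k r s))
  /-- end of a round: `aux` messages of `n - f` distinct nodes were received, all of whose values
  are delivered values; the new estimate is broadcast in the next round -/
  | endRound (σ) (i : ℕ) (k : Fin n) (r : ℕ) (Q : Finset (Fin n)) (x : Fin n → Finset Bool)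
      (hr : (σ.bin (i, k)).round = r) (hpos : 1 ≤ r)
      (hphase : (σ.bin (i, k)).phase = Phase.afterAux)
      (hQ : n ≤ Q.card + f)
      (hx : ∀ q ∈ Q, (q, Msg.aux i k r (x q)) ∈ σ.received)
      (hsub : Q.biUnion x ⊆ (σ.bin (i, k)).binValues r) :
      LocalStep vm f p σ
        ((σ.setBin i k ((σ.bin (i, k)).endRound (Q.biUnion x))).broadcast
          (Msg.est i k (r + 1) ((σ.bin (i, k)).endRound (Q.biUnion x)).est))
  /-- all `n` binary consensuses of the current instance have decided, and the blocks for which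
  `true` was decided are delivered: the superblock is decided -/
  | decideSuperblock (σ) (hrun : σ.running = true)
      (hdec : ∀ k, (σ.bin (σ.index, k)).decided ≠ none)
      (hdel : ∀ k, (σ.bin (σ.index, k)).decided = some true → σ.delivered (σ.index, k) ≠ none) :
      LocalStep vm f p σ σ.decideSuperblock
  /-- the execution engine takes the next superblock -/
  | takeSuperblock (σ) (sb : List Payload) (rest : List (List Payload))
      (hpend : σ.pending = []) (hchan : σ.commitChan = sb :: rest) :
      LocalStep vm f p σ { σ with pending := sb, commitChan := rest }
  /-- the execution engine processes the next block of the superblock -/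
  | processBlock (σ) (b : Payload) (rest : List Payload) (hpend : σ.pending = b :: rest) :
      LocalStep vm f p σ
        { σ with
          pending := rest
          vmState := (vm.processBlock (σ.vmState, σ.chain) b).1
          chain := (vm.processBlock (σ.vmState, σ.chain) b).2 }

/-- A configuration: the local states of the nodes. The entries of byzantine nodes play no role. -/
abbrev Config (n : ℕ) (Payload Tx State Hash : Type*) :=
  Fin n → NodeState n Payload Tx State Hash

/-- A step of the system, when the nodes of `byz` are byzantine: a correct node makes a local step
or receives a message. Channels are authenticated: a message received from a correct node was sent
by it. Byzantine nodes may send any message to any node at any time. Messages may be delayed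
arbitrarily, reordered and duplicated. -/
inductive Step [DecidableEq Tx] (vm : VM Payload Tx State Receipt Hash) (f : ℕ)
    (byz : Finset (Fin n)) : Config n Payload Tx State Hash → Config n Payload Tx State Hash → Prop
  | loc (C) (p : Fin n) (σ : NodeState n Payload Tx State Hash) (hp : p ∉ byz)
      (hstep : LocalStep vm f p (C p) σ) :
      Step vm f byz C (Function.update C p σ)
  | receive (C) (p q : Fin n) (m : Msg n Payload) (hp : p ∉ byz)
      (hq : q ∈ byz ∨ m ∈ (C q).sent) :
      Step vm f byz C
        (Function.update C p { C p with received := insert (q, m) (C p).received })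

/-- An execution, as the sequence of configurations at times `0, 1, 2, …`; at each time at most one
step is made, so finite executions are covered too. -/
def IsExecution [DecidableEq Tx] (vm : VM Payload Tx State Receipt Hash) (f : ℕ)
    (byz : Finset (Fin n)) (E : ℕ → Config n Payload Tx State Hash) : Prop :=
  (E 0 = fun _ => NodeState.initial n vm) ∧
    ∀ t, E (t + 1) = E t ∨ Step vm f byz (E t) (E (t + 1))

end Protocol

end SRBB

/-!
Safety of SRBB: the local chain of a correct node is the result of running the deterministic engine
on the blocks of its superblocks of instances `1, 2, …`, up to some point. Two such chains are
comparable as soon as correct nodes agree on every superblock, that is, on the decisions of the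
binary consensuses and on the delivered blocks.

Every fact used about an execution can be read off a single configuration: received and sent
messages, delivered values, decisions and delivered blocks only grow (`LocalStep.extends`), so that
the evidence for an earlier event, such as the quorum that ended a round, is still present later.
The facts form the invariant `Inv`, preserved by every step (`Inv.step`).

*Delivered blocks* (`Inv.delivered_agree`). A delivered block was the subject of a correct node's
`ready`, and the first such `ready` had a quorum of more than `(n + f) / 2` echoes behind it. Two
such quorums share a correct node, which echoes one block only.

*Binary consensus* (`Inv.decided_agree`). Two sets of `n - f` nodes share a correct node since
`3 f < n`, and its `aux` set of a round is nonempty and unique; hence the values collected by two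
correct nodes in the same round meet (`Inv.collected_inter`). If one of them collects only the
parity of the round, as it must in order to decide, then all correct nodes leave the round with this
parity as estimate. A value delivered by a correct node in a round was the estimate of a correct
node in it, so that from then on no other value is ever delivered, collected or decided
(`Inv.binValues_locked`).

Configurations at different times are compared through the monotonicity of a node's own chain.
-/

namespace SRBB

section Safety

variable {n f : ℕ} {byz : Finset (Fin n)} {Payload Tx State Receipt Hash : Type*}

/-! ### Quorums -/

theorem exists_correct_of_lt_ncard (hbyz : byz.card ≤ f) {A : Set (Fin n)} (hA : f < A.ncard) :
    ∃ q ∈ A, q ∉ byz := by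
  by_contra! h
  have : A.ncard ≤ (byz : Set (Fin n)).ncard :=
    Set.ncard_le_ncard (fun q hq => h q hq) (Set.toFinite _)
  rw [Set.ncard_coe_finset] at this
  omega

theorem exists_correct_mem_inter (hbyz : byz.card ≤ f) {A B : Set (Fin n)}
    (h : n + f < A.ncard + B.ncard) : ∃ q, q ∈ A ∧ q ∈ B ∧ q ∉ byz := by
  have h1 := Set.ncard_union_add_ncard_inter A B
  have h2 : (A ∪ B).ncard ≤ n := by
    simpa using Set.ncard_le_card (A ∪ B)
  obtain ⟨q, hq, hq'⟩ := exists_correct_of_lt_ncard hbyz (A := A ∩ B) (by omega)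
  exact ⟨q, hq.1, hq.2, hq'⟩

/-! ### Local states only grow -/

/-- `σ'` extends `σ`: messages and delivered values are never forgotten, decisions and delivered
blocks never change, and the chain is only appended to. -/
structure NodeState.Extends (σ σ' : NodeState n Payload Tx State Hash) : Prop where
  received : σ.received ⊆ σ'.received
  sent : σ.sent ⊆ σ'.sent
  binValues : ∀ a r, (σ.bin a).binValues r ⊆ (σ'.bin a).binValues r
  decided : ∀ a b, (σ.bin a).decided = some b → (σ'.bin a).decided = some b
  delivered : ∀ a v, σ.delivered a = some v → σ'.delivered a = some v
  chain : σ.chain <+: σ'.chain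

theorem NodeState.Extends.refl (σ : NodeState n Payload Tx State Hash) : σ.Extends σ :=
  ⟨subset_rfl, subset_rfl, fun _ _ => subset_rfl, fun _ _ h => h, fun _ _ h => h,
    List.prefix_rfl⟩

theorem NodeState.extends_broadcast (σ : NodeState n Payload Tx State Hash) (m : Msg n Payload) :
    σ.Extends (σ.broadcast m) :=
  { NodeState.Extends.refl σ with sent := Set.subset_insert _ _ }

theorem NodeState.Extends.trans {σ σ' σ'' : NodeState n Payload Tx State Hash}
    (h : σ.Extends σ') (h' : σ'.Extends σ'') : σ.Extends σ'' :=
  ⟨h.1.trans h'.1, h.2.trans h'.2, fun a r => (h.3 a r).trans (h'.3 a r),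
    fun a b e => h'.4 a b (h.4 a b e), fun a v e => h'.5 a v (h.5 a v e), h.6.trans h'.6⟩

theorem NodeState.extends_setBin (σ : NodeState n Payload Tx State Hash) (i : ℕ) (k : Fin n)
    (β : BinState) (hB : ∀ r, (σ.bin (i, k)).binValues r ⊆ β.binValues r)
    (hd : ∀ b, (σ.bin (i, k)).decided = some b → β.decided = some b) :
    σ.Extends (σ.setBin i k β) := by
  refine { NodeState.Extends.refl σ with binValues := ?_, decided := ?_ }
  · intro a r
    by_cases ha : a = (i, k)
    · subst ha; simpa [NodeState.setBin] using hB r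
    · simp [NodeState.setBin, ha]
  · intro a b h
    by_cases ha : a = (i, k)
    · subst ha; simpa [NodeState.setBin] using hd b h
    · simpa [NodeState.setBin, ha] using h

theorem NodeState.extends_binPropose (σ : NodeState n Payload Tx State Hash) (i : ℕ) (k : Fin n)
    (b : Bool) : σ.Extends (σ.binPropose i k b) := by
  unfold NodeState.binPropose
  split
  · refine .trans ?_ (NodeState.extends_broadcast _ _)
    exact σ.extends_setBin i k _ (fun _ => subset_rfl) fun _ h => h
  · exact .refl σ

theorem NodeState.extends_deliver (σ : NodeState n Payload Tx State Hash) {a : ℕ × Fin n}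
    (v : Payload) (hnew : σ.delivered a = none) :
    σ.Extends { σ with delivered := Function.update σ.delivered a (some v) } := by
  refine { NodeState.Extends.refl σ with delivered := ?_ }
  intro a' w ha
  by_cases h : a' = a
  · subst h; simp [hnew] at ha
  · simpa [h] using ha

theorem LocalStep.extends [DecidableEq Tx] {vm : VM Payload Tx State Receipt Hash} {p : Fin n}
    {σ σ' : NodeState n Payload Tx State Hash} (h : LocalStep vm f p σ σ') : σ.Extends σ' := by
  cases h with
  | start =>
    refine { NodeState.Extends.refl σ with sent := ?_ }
    intro m hm
    simp only [NodeState.startNewConsensus]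
    split
    · exact Set.mem_insert_of_mem _ hm
    · exact hm
  | deliver i src v hnew =>
    exact .trans (σ.extends_deliver v hnew) (NodeState.extends_binPropose _ _ _ _)
  | bvDeliver i k r b =>
    refine σ.extends_setBin i k _ (fun r' => ?_) fun _ h => h
    by_cases h : r' = r
    · subst h; simp
    · simp [h]
  | aux i k r s =>
    refine .trans ?_ (NodeState.extends_broadcast _ _)
    exact σ.extends_setBin i k _ (fun _ => subset_rfl) fun _ h => h
  | endRound i k r Q x =>
    refine .trans ?_ (NodeState.extends_broadcast _ _)
    refine σ.extends_setBin i k _ (fun _ => subset_rfl) fun b h => ?_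
    simp [BinState.endRound, h]
  | processBlock b rest =>
    exact { NodeState.Extends.refl σ with chain := List.prefix_append _ _ }
  | proposeFalse => exact NodeState.extends_binPropose _ _ _ _
  | echo | ready | bvRelay | coord => exact NodeState.extends_broadcast _ _
  | _ => exact { NodeState.Extends.refl σ with }

/-! ### What a local step adds to a local state -/

/-- The estimate with which a node leaves round `r` when the values collected are `vals`. -/
def nextEst (r : ℕ) (vals : Finset Bool) : Bool :=
  if vals = {!parity r} then !parity r else parity r

/-- The node holds what it needs to end round `r` of binary consensus `a` with the set `vals` of
collected values: `aux` messages of `n - f` distinct nodes, whose values have been delivered. -/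
def NodeState.Collected (f : ℕ) (σ : NodeState n Payload Tx State Hash) (a : ℕ × Fin n) (r : ℕ)
    (vals : Finset Bool) : Prop :=
  1 ≤ r ∧ vals ⊆ (σ.bin a).binValues r ∧ ∃ (Q : Finset (Fin n)) (x : Fin n → Finset Bool),
    n ≤ Q.card + f ∧ (∀ q ∈ Q, (q, Msg.aux a.1 a.2 r (x q)) ∈ σ.received) ∧ vals = Q.biUnion x

theorem NodeState.Collected.mono {σ σ' : NodeState n Payload Tx State Hash} {a : ℕ × Fin n} {r : ℕ}
    {vals : Finset Bool} (h : σ.Collected f a r vals) (hext : σ.Extends σ') :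
    σ'.Collected f a r vals := by
  obtain ⟨hr, hsub, Q, x, hQ, hx, rfl⟩ := h
  exact ⟨hr, hsub.trans (hext.binValues a r), Q, x, hQ, fun q hq => hext.received (hx q hq), rfl⟩

theorem NodeState.sent_binPropose {σ : NodeState n Payload Tx State Hash} {i : ℕ} {k : Fin n}
    {b : Bool} {m : Msg n Payload} (h : m ∈ (σ.binPropose i k b).sent) :
    m ∈ σ.sent ∨ m = Msg.est i k 1 b := by
  unfold NodeState.binPropose at h
  split at h
  · simpa [NodeState.broadcast, NodeState.setBin, or_comm] using h
  · exact .inl h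

theorem NodeState.bin_binPropose (σ : NodeState n Payload Tx State Hash) (i : ℕ) (k : Fin n)
    (b : Bool) (a : ℕ × Fin n) :
    ((σ.binPropose i k b).bin a).binValues = (σ.bin a).binValues ∧
      ((σ.binPropose i k b).bin a).decided = (σ.bin a).decided := by
  unfold NodeState.binPropose
  split
  · by_cases h : a = (i, k)
    · subst h; simp [NodeState.setBin, NodeState.broadcast]
    · simp [NodeState.setBin, NodeState.broadcast, h]
  · simp

theorem NodeState.delivered_binPropose (σ : NodeState n Payload Tx State Hash) (i : ℕ) (k : Fin n)
    (b : Bool) : (σ.binPropose i k b).delivered = σ.delivered := by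
  unfold NodeState.binPropose
  split <;> rfl

section LocalStep

variable [DecidableEq Tx] {vm : VM Payload Tx State Receipt Hash} {p : Fin n}
  {σ σ' : NodeState n Payload Tx State Hash}

theorem LocalStep.received_eq (h : LocalStep vm f p σ σ') : σ'.received = σ.received := by
  cases h <;> first | rfl | (unfold NodeState.binPropose; split <;> rfl)

/-- Why a correct node may have `m` among its sent messages after a step in state `σ`, if not
because it was sent before. Only the kinds of messages on which agreement rests are recorded. -/
def SendReason (f : ℕ) (σ : NodeState n Payload Tx State Hash) : Msg n Payload → Prop
  | .init _ _ => True
  | .echo i src _ => ∀ w, Msg.echo i src w ∉ σ.sent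
  | .ready i src v => n + f < 2 * σ.count (.echo i src v) ∨ f + 1 ≤ σ.count (.ready i src v)
  | .est i k r b => f + 1 ≤ σ.count (.est i k r b) ∨ r = 1 ∨
      ∃ r' vals, r = r' + 1 ∧ σ.Collected f (i, k) r' vals ∧ b = nextEst r' vals
  | .coord _ _ _ _ => True
  | .aux i k r s => s.Nonempty ∧ (σ.bin (i, k)).round = r ∧ (σ.bin (i, k)).phase = .beforeAux

theorem LocalStep.sent_cases (h : LocalStep vm f p σ σ') {m : Msg n Payload} (hm : m ∈ σ'.sent) :
    m ∈ σ.sent ∨ SendReason f σ m := by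
  by_cases hold : m ∈ σ.sent
  · exact .inl hold
  refine .inr ?_
  cases h with
  | start =>
    simp only [NodeState.startNewConsensus] at hm
    split at hm
    · obtain rfl | hm := hm
      · trivial
      · exact absurd hm hold
    · exact absurd hm hold
  | echo i src v hnew =>
    obtain rfl | hm := hm
    · exact hnew
    · exact absurd hm hold
  | ready i src v hnew htrigger =>
    obtain rfl | hm := hm
    · exact htrigger
    · exact absurd hm hold
  | deliver i src v =>
    obtain hm | rfl := NodeState.sent_binPropose hm
    · exact absurd hm hold
    · exact .inr (.inl rfl)
  | proposeFalse j k =>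
    obtain hm | rfl := NodeState.sent_binPropose hm
    · exact absurd hm hold
    · exact .inr (.inl rfl)
  | bvRelay i k r b hnew hquorum =>
    obtain rfl | hm := hm
    · exact .inl hquorum
    · exact absurd hm hold
  | coord =>
    obtain rfl | hm := hm
    · trivial
    · exact absurd hm hold
  | aux i k r s hr hpos hphase hne hs =>
    obtain rfl | hm := hm
    · refine ⟨?_, hr, hphase⟩
      obtain ⟨c, w, -, -, -, rfl⟩ | ⟨-, rfl⟩ := hs
      · exact Finset.singleton_nonempty w
      · exact Finset.nonempty_iff_ne_empty.2 hne
    · exact absurd hm hold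
  | endRound i k r Q x hr hpos hphase hQ hx hsub =>
    obtain rfl | hm := hm
    · refine .inr (.inr ⟨r, _, rfl, ⟨hpos, hsub, Q, x, hQ, hx, rfl⟩, ?_⟩)
      simp [BinState.endRound, nextEst, hr]
    · exact absurd hm hold
  | _ => exact absurd hm hold

theorem LocalStep.echo_unique (h : LocalStep vm f p σ σ')
    (hσ : ∀ i src v w, Msg.echo i src v ∈ σ.sent → Msg.echo i src w ∈ σ.sent → v = w)
    {i : ℕ} {src : Fin n} {v w : Payload} (hv : Msg.echo i src v ∈ σ'.sent)
    (hw : Msg.echo i src w ∈ σ'.sent) : v = w := by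
  cases h with
  | echo j src' u hnew =>
    simp only [NodeState.broadcast, Set.mem_insert_iff, Msg.echo.injEq] at hv hw
    grind
  | start =>
    simp only [NodeState.startNewConsensus] at hv hw
    split at hv <;> simp_all <;> exact hσ i src v w hv hw
  | deliver | proposeFalse =>
    have hv := NodeState.sent_binPropose hv
    have hw := NodeState.sent_binPropose hw
    simp only [reduceCtorEq, or_false] at hv hw
    exact hσ i src v w hv hw
  | _ =>
    try simp only [NodeState.broadcast, NodeState.setBin, Set.mem_insert_iff, reduceCtorEq,
      false_or] at hv hw
    exact hσ i src v w hv hw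

/-- The position in the binary consensus is past the broadcast of `aux` in round `r`: either in a
later round, or in round `r` after that broadcast. -/
def BinState.PastAux (β : BinState) (r : ℕ) : Prop :=
  r < β.round ∨ β.round = r ∧ β.phase = .afterAux

theorem LocalStep.pastAux (h : LocalStep vm f p σ σ') {a : ℕ × Fin n} {r : ℕ} (hr : 1 ≤ r)
    (ha : (σ.bin a).PastAux r) : (σ'.bin a).PastAux r := by
  have hset : ∀ (τ : NodeState n Payload Tx State Hash) (i : ℕ) (k : Fin n) (β : BinState),
      τ.bin = σ.bin → (((σ.bin (i, k)).PastAux r) → β.PastAux r) →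
        ((τ.setBin i k β).bin a).PastAux r := by
    intro τ i k β hτ hβ
    by_cases h : a = (i, k)
    · subst h; simpa [NodeState.setBin] using hβ ha
    · simpa [NodeState.setBin, h, hτ] using ha
  have hprop : ∀ (τ : NodeState n Payload Tx State Hash) (i : ℕ) (k : Fin n) (b : Bool),
      τ.bin = σ.bin → ((τ.binPropose i k b).bin a).PastAux r := by
    intro τ i k b hτ
    unfold NodeState.binPropose
    split
    next h0 =>
      refine hset τ i k _ hτ fun h => ?_
      rw [hτ] at h0
      simp only [BinState.PastAux] at h
      omega
    · rwa [hτ]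
  cases h with
  | deliver | proposeFalse => exact hprop _ _ _ _ rfl
  | bvDeliver => exact hset σ _ _ _ rfl fun h => h
  | aux i k r' s hr' =>
    refine hset σ i k _ rfl fun h => ?_
    simp only [BinState.PastAux] at h ⊢
    tauto
  | endRound i k r' Q x hr' =>
    refine hset σ i k _ rfl fun h => ?_
    simp only [BinState.PastAux, BinState.endRound] at h ⊢
    omega
  | _ => exact ha

/-- A node sends `aux` at most once per round, and with a nonempty set. That the position of the
sender is past the broadcast is part of the statement in order to make it inductive. -/
theorem LocalStep.aux_unique (h : LocalStep vm f p σ σ')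
    (hσ : ∀ i k r s, Msg.aux i k r s ∈ σ.sent → 1 ≤ r ∧ s.Nonempty ∧ (σ.bin (i, k)).PastAux r ∧
      ∀ s', Msg.aux i k r s' ∈ σ.sent → s = s')
    {i : ℕ} {k : Fin n} {r : ℕ} {s : Finset Bool} (hs : Msg.aux i k r s ∈ σ'.sent) :
    1 ≤ r ∧ s.Nonempty ∧ (σ'.bin (i, k)).PastAux r ∧ ∀ s', Msg.aux i k r s' ∈ σ'.sent → s = s' := by
  have key : (∀ s', Msg.aux i k r s' ∈ σ'.sent → Msg.aux i k r s' ∈ σ.sent) →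
      1 ≤ r ∧ s.Nonempty ∧ (σ'.bin (i, k)).PastAux r ∧
        ∀ s', Msg.aux i k r s' ∈ σ'.sent → s = s' := by
    intro hsub
    obtain ⟨h1, h2, h3, h4⟩ := hσ i k r s (hsub s hs)
    exact ⟨h1, h2, h.pastAux h1 h3, fun s' hs' => h4 s' (hsub s' hs')⟩
  have h' := h
  cases h with
  | aux i' k' r' s₀ hr hpos hphase hne hs₀ =>
    by_cases heq : i = i' ∧ k = k' ∧ r = r'
    · obtain ⟨rfl, rfl, rfl⟩ := heq
      -- no `aux` of this round was sent before, since the phase is still `beforeAux`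
      have hno : ∀ s', Msg.aux i k r s' ∉ σ.sent := by
        intro s' hs'
        obtain ⟨-, -, h3, -⟩ := hσ i k r s' hs'
        simp [BinState.PastAux, hr, hphase] at h3
      have hall : ∀ s', Msg.aux i k r s' ∈
          ((σ.setBin i k { σ.bin (i, k) with phase := .afterAux }).broadcast
            (Msg.aux i k r s₀)).sent → s' = s₀ := by
        rintro s' (h | h)
        · injection h
        · exact absurd h (hno s')
      obtain rfl := hall s hs
      refine ⟨hpos, ?_, ?_, fun s' h => (hall s' h).symm⟩
      · obtain hs | hs := h'.sent_cases hs
        · exact absurd hs (hno s)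
        · exact hs.1
      · simp [BinState.PastAux, NodeState.broadcast, NodeState.setBin, hr]
    · refine key ?_
      rintro s' (h | h)
      · injection h with h1 h2 h3
        exact absurd ⟨h1, h2, h3⟩ heq
      · exact h
  | start =>
    refine key fun s' h => ?_
    simp only [NodeState.startNewConsensus] at h
    split at h
    · simpa using h
    · exact h
  | deliver | proposeFalse =>
    refine key fun s' h => ?_
    simpa using NodeState.sent_binPropose h
  | _ =>
    refine key fun s' h => ?_
    first
      | exact h
      | simpa [NodeState.broadcast, NodeState.setBin] using h

theorem LocalStep.delivered_cases (h : LocalStep vm f p σ σ') {a : ℕ × Fin n} {v : Payload}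
    (hv : σ'.delivered a = some v) :
    σ.delivered a = some v ∨ 2 * f + 1 ≤ σ.count (.ready a.1 a.2 v) := by
  cases h with
  | deliver i src w hnew hquorum =>
    rw [NodeState.delivered_binPropose] at hv
    by_cases ha : a = (i, src)
    · subst ha
      simp only [Function.update_self, Option.some.injEq] at hv
      subst hv
      exact .inr hquorum
    · exact .inl (by simpa [ha] using hv)
  | proposeFalse => rw [NodeState.delivered_binPropose] at hv; exact .inl hv
  | _ => exact .inl hv

theorem LocalStep.binValues_cases (h : LocalStep vm f p σ σ') {a : ℕ × Fin n} {r : ℕ} {b : Bool}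
    (hb : b ∈ (σ'.bin a).binValues r) :
    b ∈ (σ.bin a).binValues r ∨ 2 * f + 1 ≤ σ.count (.est a.1 a.2 r b) := by
  have hset : ∀ (i : ℕ) (k : Fin n) (β : BinState), β.binValues = (σ.bin (i, k)).binValues →
      b ∈ ((σ.setBin i k β).bin a).binValues r → b ∈ (σ.bin a).binValues r := by
    intro i k β hβ h
    by_cases ha : a = (i, k)
    · subst ha; simpa [NodeState.setBin, hβ] using h
    · simpa [NodeState.setBin, ha] using h
  cases h with
  | deliver | proposeFalse => rw [(NodeState.bin_binPropose _ _ _ _ _).1] at hb; exact .inl hb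
  | aux | endRound => exact .inl (hset _ _ _ (by rfl) hb)
  | bvDeliver i k r' b' hquorum =>
    by_cases ha : a = (i, k)
    · subst ha
      by_cases hr : r = r'
      · subst hr
        simp only [NodeState.setBin, Function.update_self, Finset.mem_insert] at hb
        obtain rfl | hb := hb
        · exact .inr hquorum
        · exact .inl hb
      · exact .inl (by simpa [NodeState.setBin, hr] using hb)
    · exact .inl (by simpa [NodeState.setBin, ha] using hb)
  | _ => exact .inl hb

theorem LocalStep.decided_cases (h : LocalStep vm f p σ σ') {a : ℕ × Fin n} {b : Bool}
    (hb : (σ'.bin a).decided = some b) :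
    (σ.bin a).decided = some b ∨ ∃ r, σ.Collected f a r {parity r} ∧ b = parity r := by
  have hset : ∀ (i : ℕ) (k : Fin n) (β : BinState), β.decided = (σ.bin (i, k)).decided →
      ((σ.setBin i k β).bin a).decided = some b → (σ.bin a).decided = some b := by
    intro i k β hβ h
    by_cases ha : a = (i, k)
    · subst ha; simpa [NodeState.setBin, hβ] using h
    · simpa [NodeState.setBin, ha] using h
  cases h with
  | deliver | proposeFalse => rw [(NodeState.bin_binPropose _ _ _ _ _).2] at hb; exact .inl hb
  | aux | bvDeliver => exact .inl (hset _ _ _ (by rfl) hb)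
  | endRound i k r Q x hr hpos hphase hQ hx hsub =>
    by_cases ha : a = (i, k)
    · subst ha
      simp only [NodeState.setBin, NodeState.broadcast, Function.update_self, BinState.endRound,
        hr] at hb
      split at hb
      next hV =>
        rw [Option.or_eq_some_iff] at hb
        obtain hb | ⟨-, hb⟩ := hb
        · exact .inl hb
        · exact .inr ⟨r, ⟨hpos, hV ▸ hsub, Q, x, hQ, hx, hV.symm⟩, by simpa using hb.symm⟩
      · exact .inl hb
    · exact .inl (by simpa [NodeState.setBin, NodeState.broadcast, ha] using hb)
  | _ => exact .inl hb

end LocalStep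

/-! ### The local chain as a function of the decided superblocks -/

/-- All binary consensuses of instance `i` have decided, and the blocks for which `true` was decided
are delivered. From then on the superblock of the instance is fixed. -/
def NodeState.Complete (σ : NodeState n Payload Tx State Hash) (i : ℕ) : Prop :=
  (∀ k, (σ.bin (i, k)).decided ≠ none) ∧
    ∀ k, (σ.bin (i, k)).decided = some true → σ.delivered (i, k) ≠ none

theorem NodeState.Complete.mono {σ σ' : NodeState n Payload Tx State Hash} {i : ℕ}
    (h : σ.Complete i) (hext : σ.Extends σ') : σ'.Complete i := by
  have hdec : ∀ k, (σ'.bin (i, k)).decided = (σ.bin (i, k)).decided := fun k => by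
    obtain ⟨b, hb⟩ := Option.ne_none_iff_exists'.1 (h.1 k)
    rw [hb, hext.decided _ _ hb]
  refine ⟨fun k => hdec k ▸ h.1 k, fun k hk => ?_⟩
  obtain ⟨v, hv⟩ := Option.ne_none_iff_exists'.1 (h.2 k (hdec k ▸ hk))
  simp [hext.delivered _ _ hv]

/-- Complete instances have the same superblock at two nodes that do not contradict each other. -/
theorem NodeState.superblock_eq {σ τ : NodeState n Payload Tx State Hash} {i : ℕ}
    (hσ : σ.Complete i) (hτ : τ.Complete i)
    (hdec : ∀ k b b', (σ.bin (i, k)).decided = some b → (τ.bin (i, k)).decided = some b' → b = b')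
    (hdel : ∀ k v v', σ.delivered (i, k) = some v → τ.delivered (i, k) = some v' → v = v') :
    σ.superblock i = τ.superblock i := by
  unfold NodeState.superblock
  congr 1
  funext k
  obtain ⟨b, hb⟩ := Option.ne_none_iff_exists'.1 (hσ.1 k)
  obtain ⟨b', hb'⟩ := Option.ne_none_iff_exists'.1 (hτ.1 k)
  obtain rfl := hdec k b b' hb hb'
  rw [hb, hb']
  split
  next h =>
    obtain ⟨v, hv⟩ := Option.ne_none_iff_exists'.1 (hσ.2 k (hb.trans h))
    obtain ⟨v', hv'⟩ := Option.ne_none_iff_exists'.1 (hτ.2 k (hb'.trans h))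
    rw [hv, hv', hdel k v v' hv hv']
  · rfl

theorem NodeState.Complete.superblock_eq {σ σ' : NodeState n Payload Tx State Hash} {i : ℕ}
    (h : σ.Complete i) (hext : σ.Extends σ') : σ'.superblock i = σ.superblock i :=
  NodeState.superblock_eq (h.mono hext) h
    (fun k b b' hb hb' => by simpa [hext.decided _ _ hb'] using hb.symm)
    (fun k v v' hv hv' => by simpa [hext.delivered _ _ hv'] using hv.symm)

/-- The blocks of the superblocks of instances `1, …, m`, in order. -/
def NodeState.decidedBlocks (σ : NodeState n Payload Tx State Hash) (m : ℕ) : List Payload :=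
  (List.range m).flatMap fun j => σ.superblock (j + 1)

theorem NodeState.decidedBlocks_congr {σ τ : NodeState n Payload Tx State Hash} {m : ℕ}
    (h : ∀ j < m, σ.superblock (j + 1) = τ.superblock (j + 1)) :
    σ.decidedBlocks m = τ.decidedBlocks m := by
  simp only [NodeState.decidedBlocks, List.flatMap_def]
  congr 1
  exact List.map_congr_left fun j hj => h j (List.mem_range.1 hj)

theorem NodeState.decidedBlocks_prefix (σ : NodeState n Payload Tx State Hash) {m m' : ℕ}
    (h : m ≤ m') : σ.decidedBlocks m <+: σ.decidedBlocks m' := by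
  obtain ⟨d, rfl⟩ := Nat.exists_eq_add_of_le h
  simp only [NodeState.decidedBlocks, List.range_add, List.flatMap_append]
  exact List.prefix_append _ _

/-- State and chain after processing the blocks of a list from the genesis state. -/
def VM.run [DecidableEq Tx] (vm : VM Payload Tx State Receipt Hash) (l : List Payload) :
    State × List (ChainBlock Tx Hash) :=
  l.foldl vm.processBlock (vm.genesisState, [vm.genesisBlock])

theorem VM.run_chain_prefix [DecidableEq Tx] (vm : VM Payload Tx State Receipt Hash)
    {l l' : List Payload} (h : l <+: l') : (vm.run l).2 <+: (vm.run l').2 := by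
  obtain ⟨d, rfl⟩ := h
  induction d using List.reverseRecOn with
  | nil => simp
  | append_singleton d b ih =>
    refine ih.trans ?_
    rw [← List.append_assoc]
    simp only [VM.run, List.foldl_append, List.foldl_cons, List.foldl_nil]
    exact List.prefix_append _ _

/-- Number of instances whose superblock the node has decided. -/
def NodeState.numDecided (σ : NodeState n Payload Tx State Hash) : ℕ :=
  if σ.running then σ.index - 1 else σ.index

/-- The superblocks decided so far are those of instances `1, …, numDecided`, all complete; their
blocks are either processed, pending, or in the queue to the execution engine, in this order; and
the local chain results from the processed ones. -/
structure NodeState.ChainInv [DecidableEq Tx] (vm : VM Payload Tx State Receipt Hash)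
    (σ : NodeState n Payload Tx State Hash) : Prop where
  index_pos : σ.running = true → 1 ≤ σ.index
  complete : ∀ j < σ.numDecided, σ.Complete (j + 1)
  processed : ∃ done, done ++ (σ.pending ++ σ.commitChan.flatten) =
    σ.decidedBlocks σ.numDecided ∧ vm.run done = (σ.vmState, σ.chain)

section ChainInv

variable [DecidableEq Tx] {vm : VM Payload Tx State Receipt Hash} {p : Fin n}
  {σ σ' : NodeState n Payload Tx State Hash}

theorem NodeState.chainInv_initial : (NodeState.initial n vm).ChainInv vm where
  index_pos := by simp [NodeState.initial]
  complete := by simp [NodeState.initial, NodeState.numDecided]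
  processed := ⟨[], by simp [NodeState.initial, NodeState.numDecided, NodeState.decidedBlocks],
    rfl⟩

/-- The invariant survives a step that decides no superblock and advances the execution engine
without losing or reordering blocks. -/
theorem NodeState.ChainInv.of_numDecided_eq (h : σ.ChainInv vm) (hext : σ.Extends σ')
    (hpos : σ'.running = true → 1 ≤ σ'.index) (hnum : σ'.numDecided = σ.numDecided)
    (hproc : ∀ l done, done ++ (σ.pending ++ σ.commitChan.flatten) = l →
      vm.run done = (σ.vmState, σ.chain) → ∃ done',
        done' ++ (σ'.pending ++ σ'.commitChan.flatten) = l ∧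
          vm.run done' = (σ'.vmState, σ'.chain)) : σ'.ChainInv vm where
  index_pos := hpos
  complete j hj := (h.complete j (hnum ▸ hj)).mono hext
  processed := by
    obtain ⟨done, h1, h2⟩ := h.processed
    rw [hnum, NodeState.decidedBlocks_congr fun j hj => (h.complete j hj).superblock_eq hext]
    exact hproc _ done h1 h2

theorem NodeState.ChainInv.of_eq (h : σ.ChainInv vm) (hext : σ.Extends σ')
    (hrun : σ'.running = σ.running) (hindex : σ'.index = σ.index)
    (hpend : σ'.pending = σ.pending) (hchan : σ'.commitChan = σ.commitChan)
    (hstate : σ'.vmState = σ.vmState) (hchain : σ'.chain = σ.chain) : σ'.ChainInv vm := by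
  refine h.of_numDecided_eq hext ?_ ?_ fun l done h1 h2 => ⟨done, ?_, ?_⟩
  · rw [hrun, hindex]; exact h.index_pos
  · rw [NodeState.numDecided, NodeState.numDecided, hrun, hindex]
  · rw [hpend, hchan, h1]
  · rw [hstate, hchain, h2]

theorem LocalStep.chainInv (h : LocalStep vm f p σ σ') (hσ : σ.ChainInv vm) : σ'.ChainInv vm := by
  have hext := h.extends
  have hprop : ∀ (τ : NodeState n Payload Tx State Hash) (i : ℕ) (k : Fin n) (b : Bool),
      τ.ChainInv vm → (τ.binPropose i k b).ChainInv vm := by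
    intro τ i k b hτ
    refine hτ.of_eq (τ.extends_binPropose i k b) ?_ ?_ ?_ ?_ ?_ ?_ <;>
      unfold NodeState.binPropose <;> split <;> rfl
  cases h with
  | start hidle =>
    refine hσ.of_numDecided_eq hext ?_ ?_ fun l done h1 h2 => ⟨done, h1, h2⟩
    · simp [NodeState.startNewConsensus]
    · simp [NodeState.startNewConsensus, NodeState.numDecided, hidle]
  | decideSuperblock hrun hdec hdel =>
    have hpos := hσ.index_pos hrun
    have hnum : σ.decideSuperblock.numDecided = σ.numDecided + 1 := by
      simp only [NodeState.numDecided, NodeState.decideSuperblock, hrun]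
      simp; omega
    have hidx : σ.numDecided + 1 = σ.index := by
      simp only [NodeState.numDecided, hrun]
      simp; omega
    have hcomp : ∀ j < σ.numDecided + 1, σ.Complete (j + 1) := by
      intro j hj
      obtain hj | rfl := Nat.lt_succ_iff_lt_or_eq.1 hj
      · exact hσ.complete j hj
      · rw [hidx]; exact ⟨hdec, hdel⟩
    refine ⟨by simp [NodeState.decideSuperblock], fun j hj => ?_, ?_⟩
    · exact (hcomp j (hnum ▸ hj)).mono hext
    · obtain ⟨done, h1, h2⟩ := hσ.processed
      refine ⟨done, ?_, h2⟩
      rw [hnum, NodeState.decidedBlocks_congr fun j hj => (hcomp j hj).superblock_eq hext,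
        NodeState.decidedBlocks, List.range_succ, List.flatMap_append, ← NodeState.decidedBlocks,
        ← h1]
      simp [NodeState.decideSuperblock, hidx]
  | takeSuperblock sb rest hpend hchan =>
    refine hσ.of_numDecided_eq hext hσ.index_pos rfl fun l done h1 h2 => ⟨done, ?_, h2⟩
    simpa [hpend, hchan] using h1
  | processBlock b rest hpend =>
    refine hσ.of_numDecided_eq hext hσ.index_pos rfl fun l done h1 h2 => ⟨done ++ [b], ?_, ?_⟩
    · simpa [hpend] using h1
    · rw [VM.run, List.foldl_append, ← VM.run, h2]
      rfl
  | deliver i src v hnew =>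
    exact hprop _ _ _ _ (hσ.of_eq (σ.extends_deliver v hnew) rfl rfl rfl rfl rfl rfl)
  | proposeFalse => exact hprop _ _ _ _ hσ
  | _ => exact hσ.of_eq hext rfl rfl rfl rfl rfl rfl

end ChainInv

/-! ### Invariants of reachable configurations -/

/-- The nodes that may claim to have sent `m`: the byzantine ones and the senders of `m`. -/
def Claimants (byz : Finset (Fin n)) (C : Config n Payload Tx State Hash) (m : Msg n Payload) :
    Set (Fin n) :=
  {q | q ∈ byz ∨ m ∈ (C q).sent}

theorem Claimants.mono {C C' : Config n Payload Tx State Hash} (h : ∀ p, (C p).Extends (C' p))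
    (m : Msg n Payload) : Claimants byz C m ⊆ Claimants byz C' m :=
  fun q hq => hq.imp_right fun hm => (h q).sent hm

/-- What holds of the correct nodes in every reachable configuration. Each clause speaks of data
that only grow, so that it refers to the present configuration alone, without its history. -/
structure Inv [DecidableEq Tx] (vm : VM Payload Tx State Receipt Hash) (f : ℕ)
    (byz : Finset (Fin n)) (C : Config n Payload Tx State Hash) : Prop where
  auth : ∀ p ∉ byz, ∀ q m, (q, m) ∈ (C p).received → q ∈ Claimants byz C m
  echo_unique : ∀ p ∉ byz, ∀ i src v w, Msg.echo i src v ∈ (C p).sent →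
    Msg.echo i src w ∈ (C p).sent → v = w
  /-- A `ready` sent because of other `ready` messages inherits the quorum of echoes behind them. -/
  ready_quorum : ∀ p ∉ byz, ∀ i src v, Msg.ready i src v ∈ (C p).sent →
    n + f < 2 * (Claimants byz C (.echo i src v)).ncard
  delivered_ready : ∀ p ∉ byz, ∀ a v, (C p).delivered a = some v →
    ∃ q ∉ byz, Msg.ready a.1 a.2 v ∈ (C q).sent
  aux_unique : ∀ p ∉ byz, ∀ i k r s, Msg.aux i k r s ∈ (C p).sent →
    1 ≤ r ∧ s.Nonempty ∧ ((C p).bin (i, k)).PastAux r ∧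
      ∀ s', Msg.aux i k r s' ∈ (C p).sent → s = s'
  /-- A relayed estimate goes back to a correct node that started the round with it: by invocation
  in round 1, as the outcome of the preceding round otherwise. -/
  est_origin : ∀ p ∉ byz, ∀ i k r b, Msg.est i k r b ∈ (C p).sent →
    r = 1 ∨ ∃ q ∉ byz, ∃ r' vals, r = r' + 1 ∧ (C q).Collected f (i, k) r' vals ∧
      b = nextEst r' vals
  binValues_sent : ∀ p ∉ byz, ∀ a r b, b ∈ ((C p).bin a).binValues r →
    ∃ q ∉ byz, Msg.est a.1 a.2 r b ∈ (C q).sent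
  decided_collected : ∀ p ∉ byz, ∀ a b, ((C p).bin a).decided = some b →
    ∃ r, (C p).Collected f a r {parity r} ∧ b = parity r
  chainInv : ∀ p ∉ byz, (C p).ChainInv vm

section Invariants

variable [DecidableEq Tx] {vm : VM Payload Tx State Receipt Hash}
  {C C' : Config n Payload Tx State Hash}

theorem inv_initial : Inv vm f byz fun _ => NodeState.initial n vm where
  auth := by simp [NodeState.initial]
  echo_unique := by simp [NodeState.initial]
  ready_quorum := by simp [NodeState.initial]
  delivered_ready := by simp [NodeState.initial]
  aux_unique := by simp [NodeState.initial]
  est_origin := by simp [NodeState.initial]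
  binValues_sent := by simp [NodeState.initial, BinState.initial]
  decided_collected := by simp [NodeState.initial, BinState.initial]
  chainInv _ _ := NodeState.chainInv_initial

/-- A relation between local states holds across a step of the system at every node if it is
reflexive and holds across local steps and across receptions. -/
theorem Step.node {P : NodeState n Payload Tx State Hash → NodeState n Payload Tx State Hash → Prop}
    (h : Step vm f byz C C') (hrefl : ∀ σ, P σ σ)
    (hloc : ∀ p σ σ', LocalStep vm f p σ σ' → P σ σ')
    (hrecv : ∀ σ q m, P σ { σ with received := insert (q, m) σ.received }) (p : Fin n) :
    P (C p) (C' p) := by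
  cases h with
  | loc p' σ _ hstep =>
    by_cases h : p = p'
    · subst h; simpa using hloc p _ _ hstep
    · simpa [h] using hrefl _
  | receive p' q m =>
    by_cases h : p = p'
    · subst h; simpa using hrecv _ q m
    · simpa [h] using hrefl _

theorem Step.extends (h : Step vm f byz C C') (p : Fin n) : (C p).Extends (C' p) :=
  h.node (P := NodeState.Extends) .refl (fun _ _ _ h => h.extends)
    (fun σ _ _ => { NodeState.Extends.refl σ with received := Set.subset_insert _ _ }) p

theorem Inv.count_le (hI : Inv vm f byz C) {p : Fin n} (hp : p ∉ byz) (m : Msg n Payload) :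
    (C p).count m ≤ (Claimants byz C m).ncard :=
  Set.ncard_le_ncard (fun q hq => hI.auth p hp q m hq) (Set.toFinite _)

/-- Among `f + 1` nodes from which a message was received, a correct one did send it. -/
theorem Inv.exists_sent (hI : Inv vm f byz C) (hbyz : byz.card ≤ f) {p : Fin n} (hp : p ∉ byz)
    {m : Msg n Payload} (hm : f + 1 ≤ (C p).count m) : ∃ q ∉ byz, m ∈ (C q).sent := by
  obtain ⟨q, hq, hq'⟩ := exists_correct_of_lt_ncard hbyz (hm.trans (hI.count_le hp m))
  exact ⟨q, hq', hq.resolve_left hq'⟩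

theorem Inv.step (hI : Inv vm f byz C) (hbyz : byz.card ≤ f) (h : Step vm f byz C C') :
    Inv vm f byz C' := by
  have hext := h.extends
  have hsent : ∀ p m, m ∈ (C' p).sent → m ∈ (C p).sent ∨ SendReason f (C p) m := fun p =>
    h.node (P := fun σ σ' => ∀ m, m ∈ σ'.sent → m ∈ σ.sent ∨ SendReason f σ m)
      (fun _ _ => .inl) (fun _ _ _ h _ hm => h.sent_cases hm) (fun _ _ _ _ => .inl) p
  refine ⟨?_, ?_, ?_, ?_, ?_, ?_, ?_, ?_, ?_⟩
  · intro p hp q m hm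
    cases h with
    | loc p' σ hp' hstep =>
      refine Claimants.mono hext m (hI.auth p hp q m ?_)
      by_cases h : p = p'
      · subst h; simpa [hstep.received_eq] using hm
      · simpa [h] using hm
    | receive p' q' m' hp' hq' =>
      refine Claimants.mono hext m ?_
      by_cases h : p = p'
      · subst h
        simp only [Function.update_self, Set.mem_insert_iff, Prod.mk.injEq] at hm
        obtain ⟨rfl, rfl⟩ | hm := hm
        · exact hq'
        · exact hI.auth p hp q m hm
      · exact hI.auth p hp q m (by simpa [h] using hm)
  · intro p hp
    exact h.node (P := fun σ σ' => (∀ i src v w, Msg.echo i src v ∈ σ.sent →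
        Msg.echo i src w ∈ σ.sent → v = w) → ∀ i src v w, Msg.echo i src v ∈ σ'.sent →
        Msg.echo i src w ∈ σ'.sent → v = w)
      (fun _ h => h) (fun _ _ _ h hσ _ _ _ _ => h.echo_unique hσ) (fun _ _ _ h => h) p
      (hI.echo_unique p hp)
  · intro p hp i src v hv
    suffices n + f < 2 * (Claimants byz C (.echo i src v)).ncard from
      this.trans_le (Nat.mul_le_mul_left 2
        (Set.ncard_le_ncard (Claimants.mono hext _) (Set.toFinite _)))
    obtain hv | hv | hv := hsent p _ hv
    · exact hI.ready_quorum p hp i src v hv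
    · exact hv.trans_le (Nat.mul_le_mul_left 2 (hI.count_le hp _))
    · obtain ⟨q, hq, hq'⟩ := hI.exists_sent hbyz hp hv
      exact hI.ready_quorum q hq i src v hq'
  · intro p hp a v hv
    suffices ∃ q ∉ byz, Msg.ready a.1 a.2 v ∈ (C q).sent by
      obtain ⟨q, hq, hq'⟩ := this
      exact ⟨q, hq, (hext q).sent hq'⟩
    obtain hv | hv := h.node (P := fun σ σ' => σ'.delivered a = some v →
      σ.delivered a = some v ∨ 2 * f + 1 ≤ σ.count (.ready a.1 a.2 v))
      (fun _ => .inl) (fun _ _ _ h => h.delivered_cases) (fun _ _ _ => .inl) p hv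
    · exact hI.delivered_ready p hp a v hv
    · exact hI.exists_sent hbyz hp (by omega)
  · intro p hp
    exact h.node (P := fun σ σ' => (∀ i k r s, Msg.aux i k r s ∈ σ.sent → 1 ≤ r ∧ s.Nonempty ∧
        (σ.bin (i, k)).PastAux r ∧ ∀ s', Msg.aux i k r s' ∈ σ.sent → s = s') →
        ∀ i k r s, Msg.aux i k r s ∈ σ'.sent → 1 ≤ r ∧ s.Nonempty ∧
        (σ'.bin (i, k)).PastAux r ∧ ∀ s', Msg.aux i k r s' ∈ σ'.sent → s = s')
      (fun _ h => h) (fun _ _ _ h hσ _ _ _ _ => h.aux_unique hσ) (fun _ _ _ h => h) p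
      (hI.aux_unique p hp)
  · intro p hp i k r b hb
    suffices r = 1 ∨ ∃ q ∉ byz, ∃ r' vals, r = r' + 1 ∧ (C q).Collected f (i, k) r' vals ∧
        b = nextEst r' vals by
      refine this.imp_right ?_
      rintro ⟨q, hq, r', vals, hr, hc, hb⟩
      exact ⟨q, hq, r', vals, hr, hc.mono (hext q), hb⟩
    obtain hb | hb | hr | hb := hsent p _ hb
    · exact hI.est_origin p hp i k r b hb
    · obtain ⟨q, hq, hq'⟩ := hI.exists_sent hbyz hp hb
      exact hI.est_origin q hq i k r b hq'
    · exact .inl hr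
    · exact .inr ⟨p, hp, hb⟩
  · intro p hp a r b hb
    suffices ∃ q ∉ byz, Msg.est a.1 a.2 r b ∈ (C q).sent by
      obtain ⟨q, hq, hq'⟩ := this
      exact ⟨q, hq, (hext q).sent hq'⟩
    obtain hb | hb := h.node (P := fun σ σ' => b ∈ (σ'.bin a).binValues r →
      b ∈ (σ.bin a).binValues r ∨ 2 * f + 1 ≤ σ.count (.est a.1 a.2 r b))
      (fun _ => .inl) (fun _ _ _ h => h.binValues_cases) (fun _ _ _ => .inl) p hb
    · exact hI.binValues_sent p hp a r b hb
    · exact hI.exists_sent hbyz hp (by omega)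
  · intro p hp a b hb
    suffices ∃ r, (C p).Collected f a r {parity r} ∧ b = parity r by
      obtain ⟨r, hr, hb⟩ := this
      exact ⟨r, hr.mono (hext p), hb⟩
    obtain hb | hb := h.node (P := fun σ σ' => (σ'.bin a).decided = some b →
      (σ.bin a).decided = some b ∨ ∃ r, σ.Collected f a r {parity r} ∧ b = parity r)
      (fun _ => .inl) (fun _ _ _ h => h.decided_cases) (fun _ _ _ => .inl) p hb
    · exact hI.decided_collected p hp a b hb
    · exact hb
  · intro p hp
    exact h.node (P := fun σ σ' => σ.ChainInv vm → σ'.ChainInv vm)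
      (fun _ h => h) (fun _ _ _ h => h.chainInv)
      (fun σ _ _ h => h.of_eq
        { NodeState.Extends.refl σ with received := Set.subset_insert _ _ }
        rfl rfl rfl rfl rfl rfl) p (hI.chainInv p hp)

/-! ### Agreement -/

/-- Agreement of reliable broadcast: two quorums of `echo` messages meet in a correct node, which
echoes one block only. -/
theorem Inv.delivered_agree (hI : Inv vm f byz C) (hbyz : byz.card ≤ f) {p q : Fin n}
    (hp : p ∉ byz) (hq : q ∉ byz) {a : ℕ × Fin n} {v w : Payload}
    (hv : (C p).delivered a = some v) (hw : (C q).delivered a = some w) : v = w := by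
  obtain ⟨p', hp', hv⟩ := hI.delivered_ready p hp a v hv
  obtain ⟨q', hq', hw⟩ := hI.delivered_ready q hq a w hw
  have hv := hI.ready_quorum p' hp' _ _ _ hv
  have hw := hI.ready_quorum q' hq' _ _ _ hw
  obtain ⟨c, hcv, hcw, hc⟩ := exists_correct_mem_inter hbyz
    (A := Claimants byz C (.echo a.1 a.2 v)) (B := Claimants byz C (.echo a.1 a.2 w)) (by omega)
  exact hI.echo_unique c hc _ _ _ _ (hcv.resolve_left hc) (hcw.resolve_left hc)

/-- The sets of values collected by two correct nodes in the same round meet: the two quorums of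
`aux` messages share a correct sender, and its `aux` set is nonempty and unique. -/
theorem Inv.collected_inter (hI : Inv vm f byz C) (hf : 3 * f < n) (hbyz : byz.card ≤ f)
    {p q : Fin n} (hp : p ∉ byz) (hq : q ∉ byz) {a : ℕ × Fin n} {r : ℕ} {vals vals' : Finset Bool}
    (h : (C p).Collected f a r vals) (h' : (C q).Collected f a r vals') :
    ∃ b, b ∈ vals ∧ b ∈ vals' := by
  obtain ⟨-, -, Q, x, hQ, hx, rfl⟩ := h
  obtain ⟨-, -, Q', x', hQ', hx', rfl⟩ := h'
  obtain ⟨c, hcQ, hcQ', hc⟩ := exists_correct_mem_inter hbyz (A := (Q : Set (Fin n)))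
    (B := (Q' : Set (Fin n))) (by simp only [Set.ncard_coe_finset]; omega)
  have hs := (hI.auth p hp c _ (hx c hcQ)).resolve_left hc
  have hs' := (hI.auth q hq c _ (hx' c hcQ')).resolve_left hc
  obtain ⟨-, ⟨b, hb⟩, -, huniq⟩ := hI.aux_unique c hc _ _ _ _ hs
  exact ⟨b, Finset.mem_biUnion.2 ⟨c, hcQ, hb⟩,
    Finset.mem_biUnion.2 ⟨c, hcQ', huniq _ hs' ▸ hb⟩⟩

/-- A round in which a correct node collects only the parity of the round fixes the value of the
binary consensus: no correct node delivers another value in a later round. -/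
theorem Inv.binValues_locked (hI : Inv vm f byz C) (hf : 3 * f < n) (hbyz : byz.card ≤ f)
    {p : Fin n} (hp : p ∉ byz) {a : ℕ × Fin n} {r : ℕ} (h : (C p).Collected f a r {parity r})
    (d : ℕ) : ∀ q ∉ byz, ∀ b ∈ ((C q).bin a).binValues (r + d + 1), b = parity r := by
  induction d with
  | zero =>
    intro q hq b hb
    obtain ⟨q', hq', hest⟩ := hI.binValues_sent q hq a _ b hb
    obtain h1 | ⟨q'', hq'', r', vals, hr, hc, rfl⟩ := hI.est_origin q' hq' _ _ _ _ hest
    · have := h.1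
      omega
    · obtain rfl : r' = r := by omega
      obtain ⟨b, hb, hb'⟩ := hI.collected_inter hf hbyz hp hq'' h hc
      obtain rfl := Finset.mem_singleton.1 hb
      have : vals ≠ {!parity r'} := by
        rintro rfl
        simp at hb'
      simp [nextEst, this]
  | succ d ih =>
    intro q hq b hb
    obtain ⟨q', hq', hest⟩ := hI.binValues_sent q hq a _ b hb
    obtain h1 | ⟨q'', hq'', r', vals, hr, hc, rfl⟩ := hI.est_origin q' hq' _ _ _ _ hest
    · omega
    · obtain rfl : r' = r + d + 1 := by omega
      obtain ⟨b, hb, -⟩ := hI.collected_inter hf hbyz hq'' hq'' hc hc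
      have hvals : vals = {parity r} := Finset.eq_singleton_iff_nonempty_unique_mem.2
        ⟨⟨b, hb⟩, fun c hc' => ih q'' hq'' c (hc.2.1 hc')⟩
      -- the next estimate is the only element of `vals`, be it the parity of that round or not
      subst hvals
      cases h1 : parity r <;> cases h2 : parity (r + d + 1) <;> simp [nextEst, h2]

/-- Agreement of the binary consensus. -/
theorem Inv.decided_agree (hI : Inv vm f byz C) (hf : 3 * f < n) (hbyz : byz.card ≤ f)
    {p q : Fin n} (hp : p ∉ byz) (hq : q ∉ byz) {a : ℕ × Fin n} {b b' : Bool}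
    (hb : ((C p).bin a).decided = some b) (hb' : ((C q).bin a).decided = some b') : b = b' := by
  obtain ⟨r, hr, rfl⟩ := hI.decided_collected p hp a b hb
  obtain ⟨r', hr', rfl⟩ := hI.decided_collected q hq a b' hb'
  obtain hlt | rfl | hlt := lt_trichotomy r r'
  · obtain ⟨d, rfl⟩ := Nat.exists_eq_add_of_lt hlt
    exact (hI.binValues_locked hf hbyz hp hr d q hq _ (hr'.2.1 (by simp))).symm
  · rfl
  · obtain ⟨d, rfl⟩ := Nat.exists_eq_add_of_lt hlt
    exact hI.binValues_locked hf hbyz hq hr' d p hp _ (hr.2.1 (by simp))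

/-- Of two correct nodes, the one that decided fewer superblocks has decided an initial part of
those of the other, so both have processed initial parts of one list of blocks. -/
theorem Inv.chain_prefix (hI : Inv vm f byz C) (hf : 3 * f < n) (hbyz : byz.card ≤ f)
    {p q : Fin n} (hp : p ∉ byz) (hq : q ∉ byz) :
    (C p).chain <+: (C q).chain ∨ (C q).chain <+: (C p).chain := by
  wlog hle : (C p).numDecided ≤ (C q).numDecided generalizing p q
  · exact (this hq hp (by omega)).symm
  obtain ⟨done, h1, h2⟩ := (hI.chainInv p hp).processed
  obtain ⟨done', h1', h2'⟩ := (hI.chainInv q hq).processed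
  have hcongr : (C p).decidedBlocks (C p).numDecided = (C q).decidedBlocks (C p).numDecided :=
    NodeState.decidedBlocks_congr fun j hj => NodeState.superblock_eq
      ((hI.chainInv p hp).complete j hj) ((hI.chainInv q hq).complete j (hj.trans_le hle))
      (fun _ _ _ hb hb' => hI.decided_agree hf hbyz hp hq hb hb')
      (fun _ _ _ hv hv' => hI.delivered_agree hbyz hp hq hv hv')
  have hdone : done <+: (C q).decidedBlocks (C q).numDecided :=
    List.IsPrefix.trans ⟨_, h1.trans hcongr⟩ ((C q).decidedBlocks_prefix hle)
  have hdone' : done' <+: (C q).decidedBlocks (C q).numDecided := ⟨_, h1'⟩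
  have hchain : (vm.run done).2 = (C p).chain := by rw [h2]
  have hchain' : (vm.run done').2 = (C q).chain := by rw [h2']
  rw [← hchain, ← hchain']
  exact (List.prefix_or_prefix_of_prefix hdone hdone').imp vm.run_chain_prefix vm.run_chain_prefix

end Invariants

/-! ### Executions -/

section Execution

variable [DecidableEq Tx] {vm : VM Payload Tx State Receipt Hash}
  {E : ℕ → Config n Payload Tx State Hash}

theorem IsExecution.inv (hE : IsExecution vm f byz E) (hbyz : byz.card ≤ f) (t : ℕ) :
    Inv vm f byz (E t) := by
  induction t with
  | zero => rw [hE.1]; exact inv_initial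
  | succ t ih =>
    obtain h | h := hE.2 t
    · rwa [h]
    · exact ih.step hbyz h

theorem IsExecution.chain_mono (hE : IsExecution vm f byz E) (p : Fin n) {s t : ℕ} (h : s ≤ t) :
    (E s p).chain <+: (E t p).chain := by
  induction t, h using Nat.le_induction with
  | base => exact List.prefix_rfl
  | succ t _ ih =>
    obtain h | h := hE.2 t
    · rwa [h]
    · exact ih.trans (h.extends p).chain

theorem IsExecution.chain_prefix (hE : IsExecution vm f byz E) (hf : 3 * f < n)
    (hbyz : byz.card ≤ f) {p q : Fin n} (hp : p ∉ byz) (hq : q ∉ byz) {s t : ℕ} (h : s ≤ t) :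
    (E s p).chain <+: (E t q).chain ∨ (E t q).chain <+: (E s p).chain := by
  have hmono := hE.chain_mono p h
  obtain h' | h' := (hE.inv hbyz t).chain_prefix hf hbyz hp hq
  · exact .inl (hmono.trans h')
  · exact List.prefix_or_prefix_of_prefix hmono h'

end Execution

end Safety

end SRBB

theorem mainTheorem1 {Payload Tx State Receipt Hash : Type*} [DecidableEq Tx]
    (vm : SRBB.VM Payload Tx State Receipt Hash)
    (n f : ℕ) (hf : 3 * f < n) (byz : Finset (Fin n)) (hbyz : byz.card ≤ f)
    (E : ℕ → SRBB.Config n Payload Tx State Hash) (hE : SRBB.IsExecution vm f byz E)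
    (p q : Fin n) (hp : p ∉ byz) (hq : q ∉ byz) (s t : ℕ) :
    (E s p).chain = (E t q).chain ∨ (E s p).chain <+: (E t q).chain ∨
      (E t q).chain <+: (E s p).chain := by
  obtain h | h := le_total s t
  · exact .inr (hE.chain_prefix hf hbyz hp hq h)
  · exact .inr (hE.chain_prefix hf hbyz hq hp h).symm
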